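/- Let $I$ be an arbitrary (finite, countable or uncountable) set of agents. For each $i\in I$ let $X_i$ be a nonempty topological space, let $X=\prod_{i\in I}X_i$ carry the product topology, and let $A_i,P_i:X\to 2^{X_i}$ be set-valued maps (constraint and preference correspondences); the family $\Gamma=(X_i,A_i,P_i)_{i\in I}$ is called an abstract economy. For $T:X\to 2^{X_i}$ and $y\in X_i$ write $T^{-1}(y)=\{x\in X: y\in T(x)\}$; $T$ has open lower sections if $T^{-1}(y)$ is open in $X$ for every $y\in X_i$. Let $\Delta_n$ denote the standard $n$-simplex in $\mathbb R^{n+1}$. The economy $\Gamma$ is called $\Delta$-convex if for every $i\in I$ and every finite subset $\{p_0,\dots,p_n\}$ of $X_i$ there is a continuous map $\varphi:\Delta_n\to X_i$ such that for every $J\subseteq\{0,\dots,n\}$ and every $\lambda=(\lambda_0,\dots,\lambda_n)\in\Delta_n$ with $\lambda_j=0$ for all $j\notin J$: (a) $\varphi(\lambda)\in A_i(x)$ for all $x\in\bigcap_{j\in J}A_i^{-1}(p_j)$; and (b) $\varphi(\lambda)\in P_i(x)$ for all $x\in\bigcap_{j\in J}P_i^{-1}(p_j)$. Theorem. Suppose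 that for each $i\in I$: (i) $X_i$ is a compact Hausdorff space; (ii) $A_i(x)\neq\emptyset$ for all $x\in X$; (iii) the correspondence $x\mapsto\overline{A_i(x)}$ is upper semicontinuous; (iv) $A_i$ has open lower sections; (v) $P_i$ has open lower sections; and (vi) $x_i\notin P_i(x)$ for all $x\in X$, where $x_i$ is the $i$-th coordinate of $x$. If $\Gamma$ is $\Delta$-convex, then $\Gamma$ has an equilibrium, that is, there is $x^*\in X$ such that for every $i\in I$, $x^*_i\in\overline{A_i(x^*)}$ and $A_i(x^*)\cap P_i(x^*)=\emptyset$. -/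

import Mathlib

/-- An abstract economy: each agent `i` with choice set `X i` has a constraint correspondence `A i`
and a preference correspondence `P i`, both from the set `∀ j, X j` of profiles to subsets
of `X i`. -/
structure AbstractEconomy {I : Type*} (X : I → Type*) where
  /-- the constraint correspondences -/
  A : ∀ i, (∀ j, X j) → Set (X i)
  /-- the preference correspondences -/
  P : ∀ i, (∀ j, X j) → Set (X i)

/-- The lower section `T⁻¹(y) = {x | y ∈ T x}` of a correspondence `T` at a point `y`. -/
def lowerSection {S Y : Type*} (T : S → Set Y) (y : Y) : Set S :=
  {x | y ∈ T x}

namespace AbstractEconomy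

variable {I : Type*} {X : I → Type*} [∀ i, TopologicalSpace (X i)]

/-- `x` is an equilibrium if, for every agent, `x i` lies in the closure of `A i x` and
`A i x ∩ P i x` is empty. -/
def IsEquilibrium (Γ : AbstractEconomy X) (x : ∀ i, X i) : Prop :=
  ∀ i, x i ∈ closure (Γ.A i x) ∧ Γ.A i x ∩ Γ.P i x = ∅

/-- `Δ`-convexity: for every agent `i` and every finite subset `{p 0, …, p n}` of `X i` (listed
without repetition) there is a continuous map `φ` from the standard `n`-simplex to `X i` such that,
for every set `J` of indices, `φ` sends the face spanned by the vertices in `J` into `A i x` for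
every `x` in the intersection of the lower sections of `A i` at the `p j`, `j ∈ J`, and likewise
for `P i`. -/
def IsDeltaConvex (Γ : AbstractEconomy X) : Prop :=
  ∀ (i : I) (n : ℕ) (p : Fin (n + 1) → X i), Function.Injective p →
    ∃ φ : stdSimplex ℝ (Fin (n + 1)) → X i, Continuous φ ∧
      ∀ J : Set (Fin (n + 1)),
        (∀ x ∈ ⋂ j ∈ J, lowerSection (Γ.A i) (p j),
          ∀ l : stdSimplex ℝ (Fin (n + 1)), (∀ j, j ∉ J → (l : Fin (n + 1) → ℝ) j = 0) →
            φ l ∈ Γ.A i x) ∧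
        (∀ x ∈ ⋂ j ∈ J, lowerSection (Γ.P i) (p j),
          ∀ l : stdSimplex ℝ (Fin (n + 1)), (∀ j, j ∉ J → (l : Fin (n + 1) → ℝ) j = 0) →
            φ l ∈ Γ.P i x)

end AbstractEconomy

/-! The economy reduces to a qualitative game: let `S i x` be `A i x ∩ P i x` when `x i` lies in the
closure of `A i x`, and `A i x` otherwise. Upper semicontinuity makes the first case a closed
condition on `x`, so `S i` has open lower sections; it is irreflexive and inherits the simplex
condition. A point where every `S i` is empty is an equilibrium, because `A i x` is never empty.

Such a point exists (`exists_forall_eq_empty`): otherwise finitely many lower sections cover the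
compact product. A subordinate partition of unity maps profiles into a simplex, and the singular
simplices map it back into each `X i`. A fixed point of the composite yields a profile with `x i ∈ S
i x` for some `i`.

Brouwer's theorem is obtained from Scarf's lemma, a parity argument, applied to the lattice points
of a simplex ordered by their coordinates. -/

/-! ### Dominant sets and Scarf's lemma -/

/-- A finite set `W` is dominant for a family of preorders `ρ i` if no element is strictly above all
of `W` in every one of them. -/
def IsDominant {I V α : Type*} [LinearOrder α] (ρ : I → V → α) (W : Finset V) : Prop :=
  ∀ x, ∃ i, ∀ w ∈ W, ρ i x ≤ ρ i w

namespace IsDominant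

variable {I V α : Type*} [LinearOrder α] {ρ : I → V → α} {W : Finset V}

theorem mono {W' : Finset V} (h : IsDominant ρ W) (hW : W' ⊆ W) : IsDominant ρ W' := fun x => by
  obtain ⟨i, hi⟩ := h x
  exact ⟨i, fun w hw => hi w (hW hw)⟩

theorem exists_eq_min (hinj : ∀ i, Function.Injective (ρ i)) (h : IsDominant ρ W) {m : I → V}
    (hm : ∀ i, m i ∈ W ∧ ∀ w ∈ W, ρ i (m i) ≤ ρ i w) {w : V} (hw : w ∈ W) : ∃ i, m i = w := by
  obtain ⟨i, hi⟩ := h w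
  exact ⟨i, hinj i (le_antisymm ((hm i).2 w hw) (hi _ (hm i).1))⟩

theorem exists_min (hW : W.Nonempty) (ρ : I → V → α) :
    ∃ m : I → V, ∀ i, m i ∈ W ∧ ∀ w ∈ W, ρ i (m i) ≤ ρ i w := by
  have h : ∀ i, ∃ m, m ∈ W ∧ ∀ w ∈ W, ρ i m ≤ ρ i w := fun i => W.exists_min_image (ρ i) hW
  choose m hm using h
  exact ⟨m, hm⟩

/-- `x` is the `ρ a`-largest among the elements strictly above `m i` for `ρ i`, for all `i ≠ a`. -/
def IsTopAbove (ρ : I → V → α) (m : I → V) (a : I) (x : V) : Prop :=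
  (∀ i, i ≠ a → ρ i (m i) < ρ i x) ∧
    ∀ z, (∀ i, i ≠ a → ρ i (m i) < ρ i z) → ρ a z ≤ ρ a x

theorem IsTopAbove.eq (hinj : ∀ i, Function.Injective (ρ i)) {m : I → V} {a : I} {x y : V}
    (hx : IsTopAbove ρ m a x) (hy : IsTopAbove ρ m a y) : x = y :=
  hinj a (le_antisymm (hy.2 x hx.1) (hx.2 y hy.1))

theorem le_of_above (h : IsDominant ρ W) {m : I → V} (hm : ∀ i, m i ∈ W) {a : I} {x : V}
    (hx : ∀ i, i ≠ a → ρ i (m i) < ρ i x) : ∀ w ∈ W, ρ a x ≤ ρ a w := by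
  obtain ⟨i, hi⟩ := h x
  by_cases hia : i = a
  · exact hia ▸ hi
  · exact absurd (hi _ (hm i)) (not_le.2 (hx i hia))

theorem insert_of_isTopAbove [DecidableEq V] (h : IsDominant ρ W) {m : I → V}
    (hm : ∀ i, m i ∈ W ∧ ∀ w ∈ W, ρ i (m i) ≤ ρ i w) {a : I} {x : V}
    (hx : IsTopAbove ρ m a x) : IsDominant ρ (insert x W) := by
  intro z
  by_cases hz : ∀ i, i ≠ a → ρ i (m i) < ρ i z
  · refine ⟨a, fun w hw => ?_⟩
    rcases Finset.mem_insert.1 hw with rfl | hw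
    · exact hx.2 z hz
    · exact h.le_of_above (fun i => (hm i).1) hz w hw
  · push Not at hz
    obtain ⟨i, hia, hi⟩ := hz
    refine ⟨i, fun w hw => ?_⟩
    rcases Finset.mem_insert.1 hw with rfl | hw
    · exact hi.trans (hx.1 i hia).le
    · exact hi.trans ((hm i).2 w hw)

/-- In a dominant set with as many elements as orders, each element is the minimum for exactly one
order. The new element `x` takes over one order `a`; the other minima stay those of `W`. -/
theorem exists_isTopAbove_of_insert [Fintype I] [DecidableEq V]
    (hinj : ∀ i, Function.Injective (ρ i)) {m : I → V}
    (hm : ∀ i, m i ∈ W ∧ ∀ w ∈ W, ρ i (m i) ≤ ρ i w) (hcard : W.card + 1 = Fintype.card I)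
    {x : V} (hxW : x ∉ W) (hx : IsDominant ρ (insert x W)) :
    ∃ a, IsTopAbove ρ m a x ∧ ∀ i j, i ≠ a → j ≠ a → m i = m j → i = j := by
  obtain ⟨m', hm'⟩ := exists_min (Finset.insert_nonempty x W) ρ
  have hcard' : (insert x W).card = Fintype.card I := by
    rw [Finset.card_insert_of_notMem hxW, hcard]
  have hinj' : Function.Injective m' := by
    have : Set.InjOn m' (Finset.univ : Finset I) := by
      apply Finset.injOn_of_surjOn_of_card_le (t := insert x W) m'
      · exact fun i _ => (hm' i).1
      · intro w hw
        obtain ⟨i, hi⟩ := hx.exists_eq_min hinj hm' hw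
        exact ⟨i, by simp, hi⟩
      · rw [hcard', Finset.card_univ]
    exact fun i j hij => this (by simp) (by simp) hij
  obtain ⟨a, ha⟩ := hx.exists_eq_min hinj hm' (Finset.mem_insert_self x W)
  have hmm : ∀ i, i ≠ a → m' i = m i := by
    intro i hi
    have h1 : m' i ∈ W := by
      rcases Finset.mem_insert.1 (hm' i).1 with h | h
      · exact absurd (hinj' (h.trans ha.symm)) hi
      · exact h
    exact hinj i (le_antisymm ((hm' i).2 _ (Finset.mem_insert_of_mem (hm i).1)) ((hm i).2 _ h1))
  have habove : ∀ i, i ≠ a → ρ i (m i) < ρ i x := by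
    intro i hi
    refine lt_of_le_of_ne (hmm i hi ▸ (hm' i).2 x (Finset.mem_insert_self x W)) fun h => ?_
    exact hxW (hinj i h ▸ (hm i).1)
  refine ⟨a, ⟨habove, fun z hz => ?_⟩, fun i j hi hj hij => ?_⟩
  · refine hx.le_of_above (m := m') (fun i => (hm' i).1) (fun i hi => ?_) x
      (Finset.mem_insert_self x W)
    rw [hmm i hi]
    exact hz i hi
  · exact hinj' (by rw [hmm i hi, hmm j hj, hij])

/-- A dominant set of one element less than there are orders is contained in exactly two dominant
sets of full size, if above it there are enough elements. -/
theorem card_filter_insert_eq_two [Fintype I] [Fintype V] [DecidableEq V]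
    [DecidablePred (IsDominant ρ)]
    (hinj : ∀ i, Function.Injective (ρ i)) (h : IsDominant ρ W) (hW : W.Nonempty)
    (hcard : W.card + 1 = Fintype.card I)
    (hne : ∀ a, ∃ z, ∀ i, i ≠ a → ∃ w ∈ W, ρ i w < ρ i z) :
    (Finset.univ.filter fun x => x ∉ W ∧ IsDominant ρ (insert x W)).card = 2 := by
  obtain ⟨m, hm⟩ := exists_min hW ρ
  -- Pigeonhole: two orders share a minimum. An added element must take over one of these two, which
  -- gives the two completions.
  obtain ⟨a, b, hab, hmab⟩ : ∃ a b, a ≠ b ∧ m a = m b := by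
    obtain ⟨a, -, b, -, hab, h⟩ := Finset.exists_ne_map_eq_of_card_lt_of_maps_to
      (s := (Finset.univ : Finset I)) (t := W) (f := m)
      (by rw [Finset.card_univ]; omega) (fun i _ => (hm i).1)
    exact ⟨a, b, hab, h⟩
  have hex : ∀ a, ∃ x, IsTopAbove ρ m a x := by
    intro a
    obtain ⟨z, hz⟩ := hne a
    classical
    obtain ⟨x, hx, hmax⟩ := (Finset.univ.filter fun x => ∀ i, i ≠ a → ρ i (m i) < ρ i x)
      |>.exists_max_image (ρ a) ⟨z, by
        simp only [Finset.mem_filter, Finset.mem_univ, true_and]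
        intro i hi
        obtain ⟨w, hw, hwz⟩ := hz i hi
        exact ((hm i).2 w hw).trans_lt hwz⟩
    simp only [Finset.mem_filter, Finset.mem_univ, true_and] at hx hmax
    exact ⟨x, hx, hmax⟩
  have hnot : ∀ a b, a ≠ b → m a = m b → ∀ x, IsTopAbove ρ m a x → x ∉ W := by
    intro a b hab hmab x hx hxW
    obtain ⟨i, hi⟩ := h.exists_eq_min hinj hm hxW
    by_cases hia : i = a
    · have := hx.1 b hab.symm
      rw [← hmab, ← hia, hi] at this
      exact lt_irrefl _ this
    · have := hx.1 i hia
      rw [hi] at this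
      exact lt_irrefl _ this
  obtain ⟨x, hx⟩ := hex a
  obtain ⟨y, hy⟩ := hex b
  have hxy : x ≠ y := by
    rintro rfl
    exact absurd (h.le_of_above (fun i => (hm i).1) hy.1 _ (hm b).1) (not_le.2 (hx.1 b hab.symm))
  rw [← Finset.card_pair hxy]
  congr 1
  ext z
  simp only [Finset.mem_filter, Finset.mem_univ, true_and, Finset.mem_insert,
    Finset.mem_singleton]
  constructor
  · rintro ⟨hzW, hz⟩
    obtain ⟨d, hd, hdinj⟩ := exists_isTopAbove_of_insert hinj hm hcard hzW hz
    have : d = a ∨ d = b := by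
      by_contra! hne
      exact hab (hdinj a b hne.1.symm hne.2.symm hmab)
    rcases this with rfl | rfl
    · exact Or.inl (hd.eq hinj hx)
    · exact Or.inr (hd.eq hinj hy)
  · rintro (rfl | rfl)
    · exact ⟨hnot a b hab hmab _ hx, h.insert_of_isTopAbove hm hx⟩
    · exact ⟨hnot b a hab.symm hmab.symm _ hy, h.insert_of_isTopAbove hm hy⟩

end IsDominant

/-- If a set of `n` elements does not carry all `n` colours, the number of its subsets of size
`n - 1` carrying all colours but `i₀` is even. -/
theorem even_card_filter_image_eq_erase {I V : Type*} [Fintype I] [DecidableEq I] [Fintype V]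
    [DecidableEq V] (c : V → I) (i₀ : I) {W : Finset V} (hcard : W.card = Fintype.card I)
    (hW : W.image c ≠ Finset.univ) :
    Even ((Finset.univ.filter fun D : Finset V =>
      (D.image c = Finset.univ.erase i₀ ∧ D.card + 1 = Fintype.card I) ∧ D ⊆ W).card) := by
  by_cases hex : ∃ D : Finset V,
      (D.image c = Finset.univ.erase i₀ ∧ D.card + 1 = Fintype.card I) ∧ D ⊆ W
  swap
  · push Not at hex
    rw [Finset.filter_false_of_mem (fun D _ h => hex D h.1 h.2)]
    simp
  obtain ⟨D, ⟨hDc, hDcard⟩, hDW⟩ := hex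
  obtain ⟨x, hx⟩ : ∃ x, W \ D = {x} := by
    rw [← Finset.card_eq_one, Finset.card_sdiff_of_subset hDW]
    omega
  have hxW : x ∈ W ∧ x ∉ D := by
    have : x ∈ W \ D := by simp [hx]
    simpa using this
  have hWD : W = insert x D := by
    rw [Finset.insert_eq, ← hx, Finset.sdiff_union_of_subset hDW]
  have hinj : Set.InjOn c D := by
    rw [← Finset.card_image_iff, hDc, Finset.card_erase_of_mem (Finset.mem_univ _),
      Finset.card_univ]
    omega
  have hcx : c x ∈ D.image c := by
    rw [hDc]
    refine Finset.mem_erase.2 ⟨fun h => hW ?_, Finset.mem_univ _⟩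
    rw [hWD, Finset.image_insert, hDc, h, Finset.insert_erase (Finset.mem_univ _)]
  -- `x` and `y` are the only two elements of `W` with a common colour, so exactly their removals
  -- keep all colours but `i₀`.
  obtain ⟨y, hy, hyx⟩ := Finset.mem_image.1 hcx
  have hxy : x ≠ y := fun h => hxW.2 (h ▸ hy)
  have hne : W.erase x ≠ W.erase y := fun h => by
    have : y ∈ W.erase x := Finset.mem_erase.2 ⟨hxy.symm, hDW hy⟩
    rw [h] at this
    simp at this
  have himage : W.image c = Finset.univ.erase i₀ := by
    rw [hWD, Finset.image_insert, hDc, Finset.insert_eq_self, ← hDc]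
    exact hcx
  have hD : (Finset.univ.filter fun D : Finset V =>
      (D.image c = Finset.univ.erase i₀ ∧ D.card + 1 = Fintype.card I) ∧ D ⊆ W) =
      {W.erase x, W.erase y} := by
    ext E
    simp only [Finset.mem_filter, Finset.mem_univ, true_and, Finset.mem_insert,
      Finset.mem_singleton]
    constructor
    · rintro ⟨⟨hEc, hEcard⟩, hEW⟩
      obtain ⟨z, hz⟩ : ∃ z, W \ E = {z} := by
        rw [← Finset.card_eq_one, Finset.card_sdiff_of_subset hEW]
        omega
      have hzW : z ∈ W ∧ z ∉ E := by
        have : z ∈ W \ E := by simp [hz]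
        simpa using this
      have hEz : E = W.erase z := by
        rw [Finset.erase_eq, ← hz, Finset.sdiff_sdiff_eq_self hEW]
      by_cases hzx : z = x
      · exact Or.inl (hzx ▸ hEz)
      by_cases hzy : z = y
      · exact Or.inr (hzy ▸ hEz)
      exfalso
      have hzD : z ∈ D := by
        have := hzW.1
        rw [hWD, Finset.mem_insert] at this
        exact this.resolve_left hzx
      have : c z ∈ E.image c := by
        rw [hEc, ← himage]
        exact Finset.mem_image_of_mem c hzW.1
      obtain ⟨w, hwE, hwz⟩ := Finset.mem_image.1 this
      have hwzne : w ≠ z := fun h => hzW.2 (h ▸ hwE)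
      have hw : w ∈ insert x D := hWD ▸ hEW hwE
      rcases Finset.mem_insert.1 hw with rfl | hwD
      · exact hzy (hinj hzD hy (hwz.symm.trans hyx.symm))
      · exact hwzne (hinj hwD hzD hwz)
    · have hcard' : ∀ z ∈ W, (W.erase z).card + 1 = Fintype.card I := fun z hz => by
        rw [Finset.card_erase_add_one hz, hcard]
      rintro (rfl | rfl)
      · refine ⟨⟨?_, hcard' x hxW.1⟩, Finset.erase_subset _ _⟩
        rw [hWD, Finset.erase_insert hxW.2, hDc]
      · refine ⟨⟨?_, hcard' y (hDW hy)⟩, Finset.erase_subset _ _⟩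
        rw [← himage]
        refine subset_antisymm (Finset.image_subset_image (Finset.erase_subset _ _)) ?_
        intro i hi
        obtain ⟨w, hw, rfl⟩ := Finset.mem_image.1 hi
        by_cases hwy : w = y
        · rw [hwy, hyx]
          exact Finset.mem_image_of_mem c (Finset.mem_erase.2 ⟨hxy, hxW.1⟩)
        · exact Finset.mem_image_of_mem c (Finset.mem_erase.2 ⟨hwy, hw⟩)
  rw [hD, Finset.card_pair hne]
  exact even_two

open Finset in
/-- **Scarf's lemma**: for finitely many linear orders indexed by `I` on a finite set `T` with slack
elements added, every colouring of `T` by `I` admits a dominant set carrying all colours, where the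
slack element `inr i` has colour `i`. -/
theorem exists_isDominant_image_eq_univ {I T α : Type*} [Fintype I] [Nonempty I] [DecidableEq I]
    [Fintype T] [Nonempty T] [DecidableEq T] [LinearOrder α] (ρ : I → T ⊕ I → α)
    (hinj : ∀ i, Function.Injective (ρ i)) (hlow : ∀ i x, ρ i (Sum.inr i) ≤ ρ i x)
    (hhigh : ∀ i j t, j ≠ i → ρ i (Sum.inl t) < ρ i (Sum.inr j)) (c : T → I) :
    ∃ W : Finset (T ⊕ I), IsDominant ρ W ∧ W.image (Sum.elim c id) = univ := by
  classical
  by_contra! hno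
  obtain ⟨i₀⟩ := ‹Nonempty I›
  set c' : T ⊕ I → I := Sum.elim c id with hc'
  set R : Finset (Finset (T ⊕ I)) :=
    univ.filter fun W => IsDominant ρ W ∧ W.card = Fintype.card I with hR
  set S : Finset (Finset (T ⊕ I)) :=
    univ.filter fun D => D.image c' = univ.erase i₀ ∧ D.card + 1 = Fintype.card I with hS
  -- Rooms are the sets in `R`, doors those in `S`. Counting incidences by rooms gives an even
  -- number; by doors, an odd one.
  have hcount := sum_card_bipartiteAbove_eq_sum_card_bipartiteBelow
    (s := R) (t := S) (fun W D => D ⊆ W)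
  have heven : Even (∑ W ∈ R, #(S.bipartiteAbove (fun W D => D ⊆ W) W)) := by
    refine even_sum _ fun W hW => ?_
    rw [hR, mem_filter] at hW
    have := even_card_filter_image_eq_erase c' i₀ hW.2.2 (hno W hW.2.1)
    rwa [bipartiteAbove, hS, filter_filter]
  have hrooms : ∀ D ∈ S, #(R.bipartiteBelow (fun W D => D ⊆ W) D) =
      #(univ.filter fun x => x ∉ D ∧ IsDominant ρ (insert x D)) := by
    intro D hD
    rw [hS, mem_filter] at hD
    symm
    refine card_bij (fun x _ => insert x D) ?_ ?_ ?_
    · intro x hx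
      rw [mem_filter] at hx
      rw [mem_bipartiteBelow, hR, mem_filter]
      exact ⟨⟨mem_univ _, hx.2.2, by rw [card_insert_of_notMem hx.2.1, hD.2.2]⟩,
        subset_insert _ _⟩
    · intro x hx y _ hxy
      rw [mem_filter] at hx
      have : x ∈ insert y D := hxy ▸ mem_insert_self x D
      exact (mem_insert.1 this).resolve_right hx.2.1
    · intro W hW
      rw [mem_bipartiteBelow, hR, mem_filter] at hW
      obtain ⟨⟨-, hWd, hWc⟩, hDW⟩ := hW
      obtain ⟨x, hx⟩ : ∃ x, W \ D = {x} := by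
        rw [← card_eq_one, card_sdiff_of_subset hDW]
        omega
      have hins : insert x D = W := by
        rw [insert_eq, ← hx, sdiff_union_of_subset hDW]
      have hxD : x ∉ D := by
        have : x ∈ W \ D := by simp [hx]
        exact (mem_sdiff.1 this).2
      exact ⟨x, mem_filter.2 ⟨mem_univ _, hxD, hins ▸ hWd⟩, hins⟩
  -- The outer door, made of slack elements only: its one room adds the `ρ i₀`-largest element of
  -- `T`.
  set D₀ : Finset (T ⊕ I) := (univ.erase i₀).image Sum.inr with hD₀
  have hD₀mem : ∀ x, x ∈ D₀ ↔ ∃ i, i ≠ i₀ ∧ Sum.inr i = x := by simp [hD₀]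
  have hD₀S : D₀ ∈ S := by
    rw [hS, mem_filter]
    refine ⟨mem_univ _, ?_, ?_⟩
    · rw [hD₀, image_image]
      exact image_id
    · rw [hD₀, card_image_of_injective _ Sum.inr_injective, card_erase_add_one (mem_univ _),
        card_univ]
  have hout : #(R.bipartiteBelow (fun W D => D ⊆ W) D₀) = 1 := by
    rw [hrooms D₀ hD₀S, card_eq_one]
    obtain ⟨t, -, ht⟩ := (univ : Finset T).exists_max_image (fun t => ρ i₀ (Sum.inl t))
      univ_nonempty
    have hne : ∀ i t, ¬ ρ i (Sum.inl t) ≤ ρ i (Sum.inr i) := fun i t h =>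
      Sum.inl_ne_inr (hinj i (le_antisymm h (hlow i _)))
    refine ⟨Sum.inl t, ?_⟩
    ext x
    simp only [mem_filter, mem_univ, true_and, mem_singleton]
    constructor
    · rintro ⟨hx, hdom⟩
      have key : ∀ t', ρ i₀ (Sum.inl t') ≤ ρ i₀ x := by
        intro t'
        obtain ⟨i, hi⟩ := hdom (Sum.inl t')
        by_cases h : i = i₀
        · exact h ▸ hi x (mem_insert_self _ _)
        · exact absurd (hi _ (mem_insert_of_mem ((hD₀mem _).2 ⟨i, h, rfl⟩))) (hne i t')
      rcases x with s | j
      · exact hinj i₀ (le_antisymm (ht s (mem_univ _)) (key t))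
      · by_cases h : j = i₀
        · exact absurd (h ▸ key t) (hne i₀ t)
        · exact absurd ((hD₀mem _).2 ⟨j, h, rfl⟩) hx
    · rintro rfl
      refine ⟨by simp [hD₀], fun z => ?_⟩
      rcases z with s | j
      · refine ⟨i₀, fun w hw => ?_⟩
        rcases mem_insert.1 hw with rfl | hw
        · exact ht s (mem_univ _)
        · obtain ⟨j, hj, rfl⟩ := (hD₀mem _).1 hw
          exact (hhigh i₀ j s hj).le
      · exact ⟨j, fun w _ => hlow j w⟩
  have hodd : Odd (∑ D ∈ S, #(R.bipartiteBelow (fun W D => D ⊆ W) D)) := by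
    rw [← add_sum_erase S _ hD₀S, hout]
    refine odd_one.add_even (even_sum _ fun D hD => ?_)
    obtain ⟨hDne, hDS⟩ := mem_erase.1 hD
    have hD' := hDS
    rw [hS, mem_filter] at hD'
    by_cases hemp : R.bipartiteBelow (fun W D => D ⊆ W) D = ∅
    · simp [hemp]
    obtain ⟨W, hW⟩ := nonempty_iff_ne_empty.2 hemp
    rw [mem_bipartiteBelow, hR, mem_filter] at hW
    have hdom : IsDominant ρ D := hW.1.2.1.mono hW.2
    obtain ⟨t, ht⟩ : ∃ t, Sum.inl t ∈ D := by
      by_contra! h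
      refine hDne (subset_antisymm ?_ ?_)
      · rintro (t | j) hx
        · exact absurd hx (h t)
        · have : c' (Sum.inr j) ∈ D.image c' := mem_image_of_mem _ hx
          rw [hD'.2.1] at this
          exact (hD₀mem _).2 ⟨j, (mem_erase.1 this).1, rfl⟩
      · intro x hx
        obtain ⟨i, hi, rfl⟩ := (hD₀mem _).1 hx
        have : i ∈ D.image c' := hD'.2.1 ▸ mem_erase.2 ⟨hi, mem_univ _⟩
        obtain ⟨y, hy, hyi⟩ := mem_image.1 this
        rcases y with t | j
        · exact absurd hy (h t)
        · have : j = i := hyi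
          exact this ▸ hy
    rw [hrooms D hDS, hdom.card_filter_insert_eq_two hinj ⟨_, ht⟩ hD'.2.2 fun a =>
      ⟨Sum.inr a, fun i hi => ⟨_, ht, hhigh i a t hi.symm⟩⟩]
    exact even_two
  rw [hcount] at heven
  exact (Nat.not_even_iff_odd.2 hodd) heven

/-! ### From Scarf's lemma to Brouwer's theorem -/

/-- Every colouring of the points of height `N` in `ℕ^I` by `I` admits points of all colours close
to a common point, except for those colours in whose direction that point almost vanishes. -/
theorem exists_close_of_coloring {I : Type*} [Fintype I] [Nonempty I] [DecidableEq I] {N : ℕ}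
    {T : Finset (I → ℕ)} (hmem : ∀ t, t ∈ T ↔ ∑ i, t i = N) (c : T → I) :
    ∃ t₀ : T, ∀ i, t₀.1 i ≤ Fintype.card I ∨ ∃ t : T, c t = i ∧
        ∀ j, t.1 j ≤ t₀.1 j + Fintype.card I ∧ t₀.1 j ≤ t.1 j + Fintype.card I := by
  obtain ⟨i₀⟩ := ‹Nonempty I›
  have : Nonempty I := ⟨i₀⟩
  have : Nonempty T := ⟨⟨Pi.single i₀ N, by rw [hmem]; simp⟩⟩
  let g : I → T ⊕ I → ℤ := fun i =>
    Sum.elim (fun t => (t.1 i : ℤ)) (fun j => if j = i then -1 else N + 1)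
  let e := Fintype.equivFin (T ⊕ I)
  -- The enumeration `e` breaks ties between equal coordinates.
  let ρ : I → T ⊕ I → ℤ ×ₗ Fin (Fintype.card (T ⊕ I)) := fun i x => toLex (g i x, e x)
  have hlt : ∀ i x y, g i x < g i y → ρ i x < ρ i y := fun i x y h =>
    Prod.Lex.toLex_lt_toLex.2 (Or.inl h)
  have hle : ∀ i x y, ρ i x ≤ ρ i y → g i x ≤ g i y := fun i x y h => by
    by_contra! hgt
    exact absurd h (not_le.2 (hlt i y x hgt))
  have hTle : ∀ (t : T) i, t.1 i ≤ N := fun t i => by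
    rw [← (hmem t.1).1 t.2]
    exact Finset.single_le_sum (f := t.1) (fun _ _ => Nat.zero_le _) (Finset.mem_univ i)
  obtain ⟨W, hdom, hW⟩ := exists_isDominant_image_eq_univ ρ
    (fun i x y h => e.injective (congrArg (fun z => (ofLex z).2) h))
    (by
      intro i x
      by_cases hx : x = Sum.inr i
      · rw [hx]
      refine (hlt i _ _ ?_).le
      rcases x with t | j
      · simp only [g, Sum.elim_inr, Sum.elim_inl, if_true]
        omega
      · have : j ≠ i := fun h => hx (h ▸ rfl)
        simp only [g, Sum.elim_inr, if_true, if_neg this]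
        omega)
    (by
      intro i j t hji
      refine hlt i _ _ ?_
      have := hTle t i
      simp only [g, Sum.elim_inr, Sum.elim_inl, if_neg hji]
      omega) c
  have hdom' : ∀ t : T, ∃ i, Sum.inr i ∉ W ∧ ∀ s : T, Sum.inl s ∈ W → t.1 i ≤ s.1 i := by
    intro t
    obtain ⟨i, hi⟩ := hdom (Sum.inl t)
    refine ⟨i, fun h => ?_, fun s hs => ?_⟩
    · have := hle _ _ _ (hi _ h)
      simp only [g, Sum.elim_inr, Sum.elim_inl, if_true] at this
      omega
    · have := hle _ _ _ (hi _ hs)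
      simpa [g] using this
  have hcol : ∀ i, Sum.inr i ∈ W ∨ ∃ t : T, Sum.inl t ∈ W ∧ c t = i := by
    intro i
    obtain ⟨x, hx, hxi⟩ := Finset.mem_image.1 (hW ▸ Finset.mem_univ i)
    rcases x with t | j
    · exact Or.inr ⟨t, hx, hxi⟩
    · have : j = i := hxi
      exact Or.inl (this ▸ hx)
  obtain ⟨t₀, ht₀⟩ : ∃ t : T, Sum.inl t ∈ W := by
    obtain ⟨i, hi, -⟩ := hdom' (Classical.arbitrary T)
    obtain ⟨t, ht, -⟩ := (hcol i).resolve_left hi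
    exact ⟨t, ht⟩
  have hy : ∀ i, ∃ y : ℕ, (∀ s : T, Sum.inl s ∈ W → y ≤ s.1 i) ∧
      (Sum.inr i ∈ W → y = 0) ∧ (Sum.inr i ∉ W → ∃ s : T, Sum.inl s ∈ W ∧ s.1 i = y) := by
    intro i
    by_cases hi : Sum.inr i ∈ W
    · exact ⟨0, fun _ _ => Nat.zero_le _, fun _ => rfl, fun h => absurd hi h⟩
    · obtain ⟨s, hs, hmin⟩ := (Finset.univ.filter fun s : T => Sum.inl s ∈ W).exists_min_image
        (fun s => s.1 i) ⟨t₀, by simpa using ht₀⟩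
      simp only [Finset.mem_filter, Finset.mem_univ, true_and] at hs hmin
      exact ⟨s.1 i, hmin, fun h => absurd h hi, fun _ => ⟨s, hs, rfl⟩⟩
  choose y hy hy0 hyC using hy
  -- Otherwise some point of `T` exceeds `y` in every coordinate, against dominance. Hence points of
  -- `W` exceed `y` by little.
  have hsum : N < ∑ i, y i + Fintype.card I := by
    by_contra! hle
    have hs1 : ∑ i, (y i + 1) = ∑ i, y i + Fintype.card I := by
      simp [Finset.sum_add_distrib]
    let t : I → ℕ := fun i => y i + 1 + Pi.single (M := fun _ => ℕ) i₀ (N - ∑ i, (y i + 1)) i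
    have ht : t ∈ T := by
      rw [hmem]
      simp only [t]
      rw [Finset.sum_add_distrib, Finset.sum_pi_single']
      simp only [Finset.mem_univ, if_true]
      omega
    obtain ⟨i, hiW, hi⟩ := hdom' ⟨t, ht⟩
    obtain ⟨s, hs, hsy⟩ := hyC i hiW
    have := hi s hs
    simp only [t] at this
    omega
  have hclose : ∀ s : T, Sum.inl s ∈ W → ∀ i, s.1 i ≤ y i + Fintype.card I := by
    intro s hs i
    have h1 := (hmem s.1).1 s.2
    have h2 : ∑ j ∈ Finset.univ.erase i, y j ≤ ∑ j ∈ Finset.univ.erase i, s.1 j :=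
      Finset.sum_le_sum fun j _ => hy j s hs
    rw [← Finset.add_sum_erase _ _ (Finset.mem_univ i)] at h1 hsum
    omega
  refine ⟨t₀, fun i => (hcol i).imp (fun hi => ?_) ?_⟩
  · have := hclose t₀ ht₀ i
    rwa [hy0 i hi, zero_add] at this
  · rintro ⟨t, ht, hti⟩
    refine ⟨t, hti, fun j => ?_⟩
    have h1 := hclose t ht j
    have h2 := hclose t₀ ht₀ j
    have h3 := hy j t ht
    have h4 := hy j t₀ ht₀
    omega

theorem continuous_stdSimplex_apply {I : Type*} [Fintype I] (i : I) :
    Continuous fun x : stdSimplex ℝ I => x i :=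
  (continuous_apply i).comp continuous_subtype_val

open Filter Topology in
/-- **Brouwer's fixed point theorem** for the standard simplex. -/
theorem exists_fixedPoint_stdSimplex {I : Type*} [Fintype I] [Nonempty I]
    {f : stdSimplex ℝ I → stdSimplex ℝ I} (hf : Continuous f) : ∃ x, f x = x := by
  classical
  set n := Fintype.card I with hn
  have hcol : ∀ x : stdSimplex ℝ I, ∃ i, x i ≤ f x i := by
    intro x
    by_contra! h
    have := Finset.sum_lt_sum_of_nonempty Finset.univ_nonempty fun i (_ : i ∈ Finset.univ) => h i
    rw [stdSimplex.sum_eq_one, stdSimplex.sum_eq_one] at this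
    exact lt_irrefl _ this
  choose col hcol using hcol
  have happrox : ∀ k : ℕ, ∃ a : stdSimplex ℝ I, ∀ i, ∃ t : stdSimplex ℝ I,
      t i ≤ f t i + n / ((k : ℝ) + 1) ∧ dist t a ≤ n / ((k : ℝ) + 1) := by
    intro k
    have hk : (0 : ℝ) < (k : ℝ) + 1 := by positivity
    have hmem : ∀ t, t ∈ Finset.piAntidiag (Finset.univ : Finset I) (k + 1) ↔
        ∑ i, t i = k + 1 := fun t => by simp
    let pt : Finset.piAntidiag (Finset.univ : Finset I) (k + 1) → stdSimplex ℝ I := fun t =>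
      ⟨fun i => t.1 i / ((k : ℝ) + 1), fun i => by positivity, by
        have : ∑ i, t.1 i = k + 1 := (hmem _).1 t.2
        rw [← Finset.sum_div, ← Nat.cast_sum, this]
        push_cast
        exact div_self hk.ne'⟩
    have hpt : ∀ t i, pt t i = t.1 i / ((k : ℝ) + 1) := fun _ _ => rfl
    obtain ⟨t₀, ht₀⟩ := exists_close_of_coloring hmem (fun t => col (pt t))
    refine ⟨pt t₀, fun i => ?_⟩
    -- If coordinate `i` of `t₀` is small, `pt t₀` itself satisfies the approximate inequality, as
    -- `f` is nonnegative.
    rcases ht₀ i with h | ⟨t, hti, h⟩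
    · refine ⟨pt t₀, ?_, ?_⟩
      · have h1 := stdSimplex.zero_le (f (pt t₀)) i
        have h2 : pt t₀ i ≤ n / ((k : ℝ) + 1) := by
          rw [hpt]
          gcongr
        linarith
      · rw [dist_self]
        positivity
    · refine ⟨pt t, ?_, ?_⟩
      · have h1 := hcol (pt t)
        rw [hti] at h1
        have : (0 : ℝ) ≤ n / ((k : ℝ) + 1) := by positivity
        linarith
      · rw [Subtype.dist_eq, dist_pi_le_iff (by positivity)]
        intro j
        change dist ((t.1 j : ℝ) / (k + 1)) ((t₀.1 j : ℝ) / (k + 1)) ≤ _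
        rw [Real.dist_eq, ← sub_div, abs_div, abs_of_pos hk]
        gcongr
        have h1 : (t.1 j : ℝ) ≤ t₀.1 j + n := by exact_mod_cast (h j).1
        have h2 : (t₀.1 j : ℝ) ≤ t.1 j + n := by exact_mod_cast (h j).2
        rw [abs_le]
        constructor <;> linarith
  choose a ha using happrox
  choose t htf hta using ha
  obtain ⟨x, -, φ, hφ, hx⟩ := isCompact_univ.tendsto_subseq (x := a) fun _ => Set.mem_univ _
  have hlim : Tendsto (fun k => (n : ℝ) / ((φ k : ℝ) + 1)) atTop (𝓝 0) := by
    have : Tendsto (fun k : ℕ => (n : ℝ) / ((k : ℝ) + 1)) atTop (𝓝 0) :=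
      tendsto_const_nhds.div_atTop (tendsto_natCast_atTop_atTop.atTop_add tendsto_const_nhds)
    exact this.comp hφ.tendsto_atTop
  have hle : ∀ i, x i ≤ f x i := by
    intro i
    have ht : Tendsto (fun k => t (φ k) i) atTop (𝓝 x) := by
      refine (tendsto_iff_of_dist ?_).2 hx
      exact squeeze_zero (fun _ => dist_nonneg) (fun k => hta (φ k) i) hlim
    have h1 := ((continuous_stdSimplex_apply i).tendsto x).comp ht
    have h2 := (((continuous_stdSimplex_apply i).comp hf).tendsto x).comp ht
    have h3 := h2.add hlim
    rw [add_zero] at h3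
    exact le_of_tendsto_of_tendsto' h1 h3 fun k => htf (φ k) i
  have heq := (Finset.sum_eq_sum_iff_of_le fun i (_ : i ∈ Finset.univ) => hle i).1
    ((stdSimplex.sum_eq_one x).trans (stdSimplex.sum_eq_one (f x)).symm)
  exact ⟨x, DFunLike.ext _ _ fun i => (heq i (Finset.mem_univ i)).symm⟩

/-! ### Maximal elements of qualitative games -/

/-- Normalization of nonnegative vectors extends continuously to all of the orthant from the set
where the sum of the entries is at least `c > 0`, without enlarging supports there. -/
theorem exists_continuous_normalize {κ : Type*} [Fintype κ] [Nonempty κ] {c : ℝ} (hc : 0 < c) :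
    ∃ r : {v : κ → ℝ // ∀ j, 0 ≤ v j} → stdSimplex ℝ κ, Continuous r ∧
      ∀ v, c ≤ ∑ j, v.1 j → ∀ j, v.1 j = 0 → r v j = 0 := by
  have hcard : (0 : ℝ) < Fintype.card κ := by exact_mod_cast Fintype.card_pos
  have hpos : ∀ s : ℝ, 0 < max c s := fun s => hc.trans_le (le_max_left _ _)
  -- Any shortfall of the sum below `c` is spread equally over the entries.
  refine ⟨fun v => ⟨fun j => (v.1 j + max (c - ∑ j, v.1 j) 0 / Fintype.card κ) /
    max c (∑ j, v.1 j), fun j => ?_, ?_⟩, ?_, fun v hv j hj => ?_⟩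
  · have h1 := v.2 j
    have h2 := hpos (∑ j, v.1 j)
    positivity
  · rw [← Finset.sum_div, Finset.sum_add_distrib, Finset.sum_const, Finset.card_univ, nsmul_eq_mul,
      mul_div_cancel₀ _ hcard.ne', div_eq_one_iff_eq (hpos _).ne']
    rcases le_total c (∑ j, v.1 j) with h | h
    · rw [max_eq_right h, max_eq_right (by linarith), add_zero]
    · rw [max_eq_left h, max_eq_left (by linarith)]
      ring
  · refine Continuous.subtype_mk (continuous_pi fun j => ?_) _
    have hs : Continuous fun v : {v : κ → ℝ // ∀ j, 0 ≤ v j} => ∑ j, v.1 j :=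
      continuous_finsetSum _ fun j _ => (continuous_apply j).comp continuous_subtype_val
    have hj : Continuous fun v : {v : κ → ℝ // ∀ j, 0 ≤ v j} => v.1 j :=
      (continuous_apply j).comp continuous_subtype_val
    exact (hj.add (((continuous_const.sub hs).max continuous_const).div_const _)).div
      (continuous_const.max hs) fun v => (hpos _).ne'
  · change (v.1 j + max (c - ∑ j, v.1 j) 0 / Fintype.card κ) / max c (∑ j, v.1 j) = 0
    rw [hj, max_eq_right (by linarith)]
    simp

/-- A qualitative game on compact Hausdorff spaces, with irreflexive preferences that have open
lower sections and that are convex in the sense of singular simplices, has a maximal element. -/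
theorem exists_forall_eq_empty {I : Type*} {X : I → Type*} [∀ i, TopologicalSpace (X i)]
    [∀ i, T2Space (X i)] [∀ i, Nonempty (X i)] [∀ i, CompactSpace (X i)]
    (S : ∀ i, (∀ j, X j) → Set (X i)) (hopen : ∀ i y, IsOpen {x | y ∈ S i x})
    (hirr : ∀ i x, x i ∉ S i x)
    (hconv : ∀ i (s : Finset (X i)), s.Nonempty → ∃ φ : stdSimplex ℝ s → X i, Continuous φ ∧
      ∀ x l, (∀ j : s, l j ≠ 0 → (j : X i) ∈ S i x) → φ l ∈ S i x) :
    ∃ x, ∀ i, S i x = ∅ := by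
  classical
  by_contra! hno
  obtain ⟨t, ht⟩ := isCompact_univ.elim_finite_subcover
    (fun k : Σ i, X i => {x | k.2 ∈ S k.1 x}) (fun k => hopen k.1 k.2) fun x _ => by
      obtain ⟨i, y, hy⟩ := hno x
      exact Set.mem_iUnion.2 ⟨⟨i, y⟩, hy⟩
  obtain ⟨x₀⟩ : Nonempty (∀ i, X i) := inferInstance
  have htne : Nonempty t := by
    obtain ⟨k, hk, -⟩ := Set.mem_iUnion₂.1 (ht (Set.mem_univ x₀))
    exact ⟨⟨k, hk⟩⟩
  obtain ⟨f, hf⟩ := PartitionOfUnity.exists_isSubordinate isClosed_univ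
    (fun k : t => {x | k.1.2 ∈ S k.1.1 x}) (fun k => hopen k.1.1 k.1.2) fun x hx => by
      obtain ⟨k, hk, hkx⟩ := Set.mem_iUnion₂.1 (ht hx)
      exact Set.mem_iUnion.2 ⟨⟨k, hk⟩, hkx⟩
  have hfS : ∀ k x, f k x ≠ 0 → k.1.2 ∈ S k.1.1 x := fun k x h => hf k (subset_tsupport _ h)
  -- Every point of the simplex on `t` has a coordinate at least `c`, so at least one agent's
  -- weights are normalized without enlarging their support.
  set c : ℝ := 1 / Fintype.card t with hc
  have hcard : (0 : ℝ) < Fintype.card t := by exact_mod_cast Fintype.card_pos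
  have hcpos : 0 < c := by positivity
  have hψ : ∀ i, ∃ ψ : stdSimplex ℝ t → X i, Continuous ψ ∧ ∀ μ x, (∃ k : t, k.1.1 = i ∧ c ≤ μ k) →
      (∀ k : t, μ k ≠ 0 → k.1.2 ∈ S k.1.1 x) → ψ μ ∈ S i x := by
    intro i
    set s : Finset (X i) := t.preimage (Sigma.mk i) sigma_mk_injective.injOn with hs
    have hmem : ∀ {y}, y ∈ s → (⟨i, y⟩ : Σ i, X i) ∈ t := fun h => Finset.mem_preimage.1 h
    by_cases hsne : s.Nonempty
    swap
    · refine ⟨fun _ => x₀ i, continuous_const, ?_⟩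
      rintro μ x ⟨⟨⟨i', y⟩, hk⟩, rfl, -⟩ -
      exact absurd ⟨y, Finset.mem_preimage.2 hk⟩ hsne
    obtain ⟨φ, hφ, hφS⟩ := hconv i s hsne
    have : Nonempty s := hsne.to_subtype
    obtain ⟨r, hr, hr0⟩ := exists_continuous_normalize (κ := s) hcpos
    let v : stdSimplex ℝ t → {v : s → ℝ // ∀ j, 0 ≤ v j} := fun μ =>
      ⟨fun j => μ ⟨⟨i, j.1⟩, hmem j.2⟩, fun j => stdSimplex.zero_le μ _⟩
    have hv : Continuous v := Continuous.subtype_mk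
      (continuous_pi fun j => continuous_stdSimplex_apply _) _
    refine ⟨fun μ => φ (r (v μ)), hφ.comp (hr.comp hv), ?_⟩
    rintro μ x ⟨⟨⟨i', y⟩, hk⟩, rfl, hck⟩ hμ
    refine hφS x _ fun j hj => hμ ⟨⟨_, j.1⟩, hmem j.2⟩ fun h0 => hj (hr0 _ ?_ j h0)
    exact hck.trans (Finset.single_le_sum (f := (v μ).1) (fun j _ => (v μ).2 j)
      (Finset.mem_univ (⟨y, Finset.mem_preimage.2 hk⟩ : s)))
  choose ψ hψc hψS using hψ
  let F : stdSimplex ℝ t → stdSimplex ℝ t := fun μ =>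
    ⟨fun k => f k (fun i => ψ i μ), fun k => f.nonneg k _, by
      rw [← finsum_eq_sum_of_fintype]
      exact f.sum_eq_one (Set.mem_univ _)⟩
  obtain ⟨μ, hμ⟩ := exists_fixedPoint_stdSimplex (f := F) (Continuous.subtype_mk
    (continuous_pi fun k => (f k).continuous.comp (continuous_pi hψc)) _)
  obtain ⟨k, hk⟩ : ∃ k, c ≤ μ k := by
    by_contra! h
    have := Finset.sum_lt_sum_of_nonempty Finset.univ_nonempty
      fun k (_ : k ∈ Finset.univ) => h k
    rw [stdSimplex.sum_eq_one, Finset.sum_const, Finset.card_univ, nsmul_eq_mul, hc,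
      mul_one_div_cancel hcard.ne'] at this
    exact lt_irrefl _ this
  refine hirr k.1.1 (fun i => ψ i μ) (hψS _ μ _ ⟨k, rfl, hk⟩ fun j hj => hfS j _ fun h => hj ?_)
  rw [← hμ]
  exact h

/-! ### Reduction of the economy to a qualitative game -/

namespace AbstractEconomy

variable {I : Type*} {X : I → Type*} [∀ i, TopologicalSpace (X i)]

/-- Take `J` to be the support of `l`. A single `φ` serves `A` and `P`, hence also their
intersection. -/
theorem IsDeltaConvex.exists_continuous_of_finset {Γ : AbstractEconomy X} (hΔ : Γ.IsDeltaConvex)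
    (i : I) {s : Finset (X i)} (hs : s.Nonempty) :
    ∃ φ : stdSimplex ℝ s → X i, Continuous φ ∧
      (∀ x l, (∀ j : s, l j ≠ 0 → (j : X i) ∈ Γ.A i x) → φ l ∈ Γ.A i x) ∧
      ∀ x l, (∀ j : s, l j ≠ 0 → (j : X i) ∈ Γ.P i x) → φ l ∈ Γ.P i x := by
  obtain ⟨n, hn⟩ : ∃ n, s.card = n + 1 := Nat.exists_eq_succ_of_ne_zero hs.card_pos.ne'
  let e : Fin (n + 1) ≃ s := (finCongr hn.symm).trans s.equivFin.symm
  obtain ⟨φ, hφ, hφS⟩ := hΔ i n (fun j => e j) (Subtype.val_injective.comp e.injective)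
  let g : stdSimplex ℝ s → stdSimplex ℝ (Fin (n + 1)) := fun l =>
    ⟨fun j => l (e j), fun j => stdSimplex.zero_le l _, by
      rw [e.sum_comp (fun j => l j)]
      exact stdSimplex.sum_eq_one l⟩
  have hg : Continuous g := Continuous.subtype_mk
    (continuous_pi fun j => continuous_stdSimplex_apply _) _
  refine ⟨φ ∘ g, hφ.comp hg, fun x l h => ?_, fun x l h => ?_⟩
  · exact (hφS {j | l (e j) ≠ 0}).1 x (Set.mem_iInter₂.2 fun j hj => h (e j) hj) (g l)
      fun j hj => not_not.1 hj
  · exact (hφS {j | l (e j) ≠ 0}).2 x (Set.mem_iInter₂.2 fun j hj => h (e j) hj) (g l)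
      fun j hj => not_not.1 hj

end AbstractEconomy

/-- If `x i ∉ T x`, regularity separates them by open sets, and upper semicontinuity keeps `T z` and
`z i` apart for `z` near `x`. -/
theorem isClosed_setOf_apply_mem_of_upperHemicontinuous {I : Type*} {X : I → Type*}
    [∀ i, TopologicalSpace (X i)] {i : I} [RegularSpace (X i)] {T : (∀ j, X j) → Set (X i)}
    (hT : UpperHemicontinuous T) (hclosed : ∀ x, IsClosed (T x)) :
    IsClosed {x : ∀ j, X j | x i ∈ T x} := by
  rw [← isOpen_compl_iff, isOpen_iff_mem_nhds]
  intro x hx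
  obtain ⟨V, U, hV, hU, hTV, hxU, hUV⟩ : SeparatedNhds (T x) {x i} :=
    (separatedNhds_iff_disjoint.2 (by
      rw [nhdsSet_singleton]
      exact RegularSpace.regular (hclosed x) hx))
  filter_upwards [hT.forall_isOpen x V hV hTV,
    (continuous_apply i).continuousAt.preimage_mem_nhds (hU.mem_nhds (hxU rfl))] with z hz hzU hzT
  exact Set.disjoint_left.1 hUV (hz hzT) hzU

theorem theorem1 {I : Type*} {X : I → Type*} [∀ i, TopologicalSpace (X i)]
    [∀ i, T2Space (X i)] [∀ i, Nonempty (X i)] [∀ i, CompactSpace (X i)]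
    (Γ : AbstractEconomy X)
    (hA_nonempty : ∀ i x, (Γ.A i x).Nonempty)
    (hA_usc : ∀ i, UpperHemicontinuous (fun x => closure (Γ.A i x)))
    (hA_open : ∀ i, HasOpenLowerSections (Γ.A i))
    (hP_open : ∀ i, HasOpenLowerSections (Γ.P i))
    (hP_irrefl : ∀ i (x : ∀ j, X j), x i ∉ Γ.P i x)
    (hΔ : Γ.IsDeltaConvex) :
    ∃ x : ∀ i, X i, Γ.IsEquilibrium x := by
  have hAo : ∀ i y, IsOpen {x | y ∈ Γ.A i x} := fun i =>
    hasOpenLowerSections_iff_isOpen.1 (hA_open i)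
  have hPo : ∀ i y, IsOpen {x | y ∈ Γ.P i x} := fun i =>
    hasOpenLowerSections_iff_isOpen.1 (hP_open i)
  have hF : ∀ i, IsClosed {x : ∀ j, X j | x i ∈ closure (Γ.A i x)} := fun i =>
    isClosed_setOf_apply_mem_of_upperHemicontinuous (hA_usc i) fun _ => isClosed_closure
  obtain ⟨x, hx⟩ := exists_forall_eq_empty
    (fun i x => {y | y ∈ Γ.A i x ∧ (x i ∈ closure (Γ.A i x) → y ∈ Γ.P i x)})
    (fun i y => by
      have : {x : ∀ j, X j | y ∈ Γ.A i x ∧ (x i ∈ closure (Γ.A i x) → y ∈ Γ.P i x)} =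
          {x | y ∈ Γ.A i x} ∩ ({x | x i ∈ closure (Γ.A i x)}ᶜ ∪ {x | y ∈ Γ.P i x}) := by
        ext x
        simp [imp_iff_not_or]
      exact this ▸ (hAo i y).inter ((hF i).isOpen_compl.union (hPo i y)))
    (fun i x hx => hP_irrefl i x (hx.2 (subset_closure hx.1)))
    (fun i s hs => by
      obtain ⟨φ, hφ, hA, hP⟩ := hΔ.exists_continuous_of_finset i hs
      exact ⟨φ, hφ, fun x l h => ⟨hA x l fun j hj => (h j hj).1,
        fun hxi => hP x l fun j hj => (h j hj).2 hxi⟩⟩)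
  have hmem : ∀ i, x i ∈ closure (Γ.A i x) := by
    intro i
    by_contra h
    obtain ⟨y, hy⟩ := hA_nonempty i x
    exact Set.eq_empty_iff_forall_notMem.1 (hx i) y ⟨hy, fun h' => absurd h' h⟩
  refine ⟨x, fun i => ⟨hmem i, ?_⟩⟩
  rw [Set.eq_empty_iff_forall_notMem]
  exact fun y hy => Set.eq_empty_iff_forall_notMem.1 (hx i) y ⟨hy.1, fun _ => hy.2⟩
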